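/- Let $Z=\{x_1,\dots,x_n\}$ be a finite set of $n$ alternatives. A choice rule assigns to each pair $x\ne y$ in $Z$ a probability $\rho(x,y)\in[0,1]$ with $\rho(x,y)+\rho(y,x)=1$, and is identified with the vector $(\rho(x_i,x_j))_{i<j}\in[0,1]^{m}$, $m=\binom n2$. Consider the following representations, each required for all $x\neq y$ in $Z$. - Random Utility (RU): $\rho(x,y)=\sum_{\pi}\nu(\pi)\mathbf 1\{\pi(x)\ge\pi(y)\}$ for a probability distribution $\nu$ on the bijections $\pi:Z\to\{1,\dots,n\}$. - Simple Scalability (SS): $\rho(x,y)=F(u(x),u(y))$ for some $u:Z\to\mathbb R$ and some $F:\mathbb R\times\mathbb R\to(0,1)$ that is strictly increasing in the first and strictly decreasing in the second argument, with $F(a,b)=1-F(b,a)$ for all $a,b$. - Weak Utility (WU): $\rho(x,y)=F\big((u(x)-u(y))/c(x,y)\big)$ for some $u:Z\to\mathbb R$, some strictly increasing $F:\mathbb R\to[0,1]$ with $F(t)=1-F(-t)$ for all $t$, and some semimetric $c:Z^2\to[0,\infty)$, that is, $c(x,y)=0$ if and only if $x=y$, and $c(x,y)=c(y,x)$. - Moderate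 Utility (MU): as WU, where $c$ moreover satisfies the triangle inequality $c(x,z)\le c(x,y)+c(y,z)$. For $M\in\{\mathrm{SS},\mathrm{MU},\mathrm{WU}\}$, a rule $\rho$ has a Collective $M$ representation if $\rho=\sum_{i=1}^N\lambda_i\rho_i$ for some positive integer $N$, weights $\lambda_i>0$ with sum $1$, and choice rules $\rho_i$ that each have an $M$ representation. Let $\mathcal R^{\mathrm{RU}}_n\subseteq[0,1]^m$ be the set of vectors with an RU representation, and let $\mathcal C^{M}_n\subseteq[0,1]^m$ be the closure of the set of vectors with a Collective $M$ representation. Then: (i) $\mathcal R^{\mathrm{RU}}_n\subseteq\mathcal C^{\mathrm{SS}}_n$ for every $n$, with $\mathcal R^{\mathrm{RU}}_n=\mathcal C^{\mathrm{SS}}_n$ for $n\le 6$ and $\mathcal R^{\mathrm{RU}}_n\subsetneq\mathcal C^{\mathrm{SS}}_n$ for $n\ge 7$. (ii) $\mathcal C^{\mathrm{SS}}_n\subseteq\mathcal C^{\mathrm{MU}}_n$ for every $n$, with $\mathcal C^{\mathrm{SS}}_n=\mathcal C^{\mathrm{MU}}_n$ for $n\le 5$ and $\mathcal C^{\mathrm{SS}}_n\subsetneq\mathcal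 C^{\mathrm{MU}}_n$ for $n\ge 6$. (iii) $\mathcal C^{\mathrm{MU}}_n\subsetneq\mathcal C^{\mathrm{WU}}_n$ for every $n\ge 3$. -/

import Mathlib

/-- The unordered pairs of alternatives, the alternatives being `0, …, n - 1`: each two-element menu
`{i, j}` is represented by `(i, j)` with `i < j`. There are `n.choose 2` of them. -/
abbrev Menu (n : ℕ) : Type := {p : Fin n × Fin n // p.1 < p.2}

/-- Choice vectors: the entry at `(i, j)` with `i < j` is the probability of choosing `i` over
`j`. -/
abbrev ChoiceVec (n : ℕ) : Type := Menu n → ℝ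

/-- The choice rule encoded by a choice vector: `choiceProb ρ x y` is the probability that `x` is
chosen over `y`, so that `choiceProb ρ x y + choiceProb ρ y x = 1` for `x ≠ y`. (The value on the
diagonal, which is not a menu, is never used.) -/
noncomputable def choiceProb {n : ℕ} (ρ : ChoiceVec n) (x y : Fin n) : ℝ :=
  if hxy : x < y then ρ ⟨(x, y), hxy⟩
  else if hyx : y < x then 1 - ρ ⟨(y, x), hyx⟩
  else 1 / 2

/-- Simple Scalability representation. -/
def HasSSRep {n : ℕ} (ρ : ChoiceVec n) : Prop :=
  ∃ (u : Fin n → ℝ) (F : ℝ → ℝ → ℝ),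
    (∀ a b, F a b ∈ Set.Ioo (0 : ℝ) 1) ∧
    (∀ b, StrictMono fun a => F a b) ∧
    (∀ a, StrictAnti fun b => F a b) ∧
    (∀ a b, F a b = 1 - F b a) ∧
    ∀ x y, x ≠ y → choiceProb ρ x y = F (u x) (u y)

/-- Semimetrics: nonnegative, zero exactly on the diagonal, symmetric. -/
def IsSemimetric {Z : Type*} (c : Z → Z → ℝ) : Prop :=
  (∀ x y, 0 ≤ c x y) ∧ (∀ x y, c x y = 0 ↔ x = y) ∧ ∀ x y, c x y = c y x

/-- Distance metrics: semimetrics that satisfy the triangle inequality. -/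
def IsDistanceMetric {Z : Type*} (c : Z → Z → ℝ) : Prop :=
  IsSemimetric c ∧ ∀ x y z, c x z ≤ c x y + c y z

/-- `ρ(x, y) = F((u(x) - u(y)) / c(x, y))` on all two-element menus, with `F : ℝ → [0, 1]` strictly
increasing and `F(t) = 1 - F(-t)`. -/
def IsRatioRep {n : ℕ} (ρ : ChoiceVec n) (u : Fin n → ℝ) (F : ℝ → ℝ)
    (c : Fin n → Fin n → ℝ) : Prop :=
  (∀ t, F t ∈ Set.Icc (0 : ℝ) 1) ∧
  StrictMono F ∧
  (∀ t, F t = 1 - F (-t)) ∧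
  ∀ x y, x ≠ y → choiceProb ρ x y = F ((u x - u y) / c x y)

/-- Moderate Utility representation. -/
def HasMURep {n : ℕ} (ρ : ChoiceVec n) : Prop :=
  ∃ (u : Fin n → ℝ) (F : ℝ → ℝ) (c : Fin n → Fin n → ℝ),
    IsDistanceMetric c ∧ IsRatioRep ρ u F c

/-- Weak Utility representation. -/
def HasWURep {n : ℕ} (ρ : ChoiceVec n) : Prop :=
  ∃ (u : Fin n → ℝ) (F : ℝ → ℝ) (c : Fin n → Fin n → ℝ),
    IsSemimetric c ∧ IsRatioRep ρ u F c

/-- `ρ` is a finite mixture, with positive weights, of choice vectors that satisfy the model `M`. -/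
def HasCollectiveRep {n : ℕ} (M : ChoiceVec n → Prop) (ρ : ChoiceVec n) : Prop :=
  ∃ (N : ℕ) (w : Fin N → ℝ) (r : Fin N → ChoiceVec n),
    0 < N ∧ (∀ i, 0 < w i) ∧ ∑ i, w i = 1 ∧ (∀ i, M (r i)) ∧
    ∀ x y, x ≠ y → choiceProb ρ x y = ∑ i, w i * choiceProb (r i) x y

/-- Random Utility representation: a probability distribution `ν` on the bijections `π` (strict
preferences, a larger value being better). -/
def HasRURep {n : ℕ} (ρ : ChoiceVec n) : Prop :=
  ∃ ν : Equiv.Perm (Fin n) → ℝ,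
    (∀ π, 0 ≤ ν π) ∧ ∑ π, ν π = 1 ∧
    ∀ x y, x ≠ y → choiceProb ρ x y = ∑ π, ν π * (if π y ≤ π x then 1 else 0)

/-- The choice vectors rationalized by Random Utility (a polytope, hence already closed). -/
def setRU (n : ℕ) : Set (ChoiceVec n) := {ρ | HasRURep ρ}

/-- The rationalizable set of Collective Simple Scalability: the closure of the set of choice
vectors with such a representation. -/
def setCollectiveSS (n : ℕ) : Set (ChoiceVec n) := closure {ρ | HasCollectiveRep HasSSRep ρ}

/-- The rationalizable set of Collective Moderate Utility (closed as above). -/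
def setCollectiveMU (n : ℕ) : Set (ChoiceVec n) := closure {ρ | HasCollectiveRep HasMURep ρ}

/-- The rationalizable set of Collective Weak Utility (closed as above). -/
def setCollectiveWU (n : ℕ) : Set (ChoiceVec n) := closure {ρ | HasCollectiveRep HasWURep ρ}

/-! Attach to a relation `R` contained in a linear order the vector `relVec R`, with entries 0 and 1
on comparable pairs and 1/2 on incomparable ones. A rule with a representation is an average of such
vectors over its level relations, the pairs chosen with probability at least `t`
(`mem_of_levels_mem`). For Simple Scalability the levels are semiorders (`mem_of_hasSSRep`), for
Moderate Utility they are transitive (`mem_of_hasMURep`). Conversely, steep sigmoids make `relVec R`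
a limit of model rules: of MU rules for transitive `R`, of WU rules for any `R` contained in a
linear order (`relVec_mem_closure_of_stretchDist`), and of SS rules when `R` is a utility gap above
1 (`relVec_mem_closure_SS`).

If `R` is the intersection of two linear orders, `relVec R` is their mean and so lies in the Random
Utility polytope. Semiorders on at most 6 points and posets on at most 5 are such intersections, by
a finite check; this gives the equalities.

Strictness comes from three relations: a seven-point semiorder, the six-point standard example of
dimension three, and an intransitive chain on three points. Each violates an inequality satisfied by
every linear order, or by every linear extension of the relation. -/

open Filter Topology MeasureTheory

variable {n m : ℕ}

/-! ### Choice vectors, half-vectors of relations, and the Random Utility polytope. -/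

open Classical in
/-- The choice vector of `R`: probability one along `R`, one half for incomparable pairs. -/
noncomputable def relVec (R : Fin n → Fin n → Prop) : ChoiceVec n := fun p =>
  if R p.1.1 p.1.2 then 1 else if R p.1.2 p.1.1 then 0 else 1 / 2

/-- The choice vector of a strict preference. -/
def permVec (π : Equiv.Perm (Fin n)) : ChoiceVec n := fun p => if π p.1.2 ≤ π p.1.1 then 1 else 0

def restrictVec (e : Fin m ↪o Fin n) (ρ : ChoiceVec n) : ChoiceVec m := fun p =>
  ρ ⟨(e p.1.1, e p.1.2), e.lt_iff_lt.2 p.2⟩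

theorem choiceProb_of_lt (ρ : ChoiceVec n) {x y : Fin n} (h : x < y) :
    choiceProb ρ x y = ρ ⟨(x, y), h⟩ := by
  simp [choiceProb, h]

theorem choiceProb_add_swap (ρ : ChoiceVec n) (x y : Fin n) :
    choiceProb ρ x y + choiceProb ρ y x = 1 := by
  rcases lt_trichotomy x y with h | h | h
  · simp [choiceProb, h, h.not_gt]
  · subst h; norm_num [choiceProb]
  · simp [choiceProb, h, h.not_gt]

theorem continuous_choiceProb (x y : Fin n) : Continuous fun ρ : ChoiceVec n => choiceProb ρ x y := by
  unfold choiceProb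
  split_ifs <;> fun_prop

theorem choiceProb_combo {a b : ℝ} (hab : a + b = 1) (ρ σ : ChoiceVec n) (x y : Fin n) :
    choiceProb (a • ρ + b • σ) x y = a * choiceProb ρ x y + b * choiceProb σ x y := by
  unfold choiceProb
  split_ifs
  · simp
  · simp only [Pi.add_apply, Pi.smul_apply, smul_eq_mul]; linear_combination -hab
  · linear_combination -(1 / 2) * hab

theorem choiceProb_eq_sum_iff {ι : Type*} [Fintype ι] {w : ι → ℝ} (hw : ∑ i, w i = 1)
    (r : ι → ChoiceVec n) (ρ : ChoiceVec n) :
    (∀ x y, x ≠ y → choiceProb ρ x y = ∑ i, w i * choiceProb (r i) x y) ↔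
      ∑ i, w i • r i = ρ := by
  constructor
  · intro h
    funext ⟨⟨x, y⟩, hxy⟩
    have := h x y hxy.ne
    simp only [choiceProb_of_lt _ hxy] at this
    simp [this]
  · rintro rfl x y hxy
    have key : ∀ x y : Fin n, x < y →
        choiceProb (∑ i, w i • r i) x y = ∑ i, w i * choiceProb (r i) x y := by
      intro x y hxy
      simp [choiceProb_of_lt _ hxy]
    rcases hxy.lt_or_gt with h | h
    · exact key x y h
    · rw [eq_sub_of_add_eq (choiceProb_add_swap _ x y), key y x h, ← hw,
        ← Finset.sum_sub_distrib]
      refine Finset.sum_congr rfl fun i _ => ?_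
      linear_combination (-w i) * choiceProb_add_swap (r i) y x

theorem choiceProb_restrictVec (e : Fin m ↪o Fin n) (ρ : ChoiceVec n) (x y : Fin m) :
    choiceProb (restrictVec e ρ) x y = choiceProb ρ (e x) (e y) := by
  simp [choiceProb, restrictVec]

theorem choiceProb_relVec {R : Fin n → Fin n → Prop} (hR : ∀ x y, R x y → ¬ R y x) (x y : Fin n)
    [Decidable (R x y)] [Decidable (R y x)] :
    choiceProb (relVec R) x y = if R x y then 1 else if R y x then 0 else 1 / 2 := by
  have h1 := hR x y
  have h3 := hR x x
  rcases lt_trichotomy x y with h | h | h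
  · simp only [choiceProb, h, relVec, dite_true]
    split_ifs <;> rfl
  · subst h
    simp only [choiceProb, lt_self_iff_false, dite_false]
    rw [if_neg, if_neg] <;> exact fun h => h3 h h
  · simp only [choiceProb, h, relVec, h.not_gt, dite_true, dite_false]
    split_ifs <;> first | exact absurd ‹R y x› (h1 ‹_›) | norm_num

theorem choiceProb_permVec (π : Equiv.Perm (Fin n)) {x y : Fin n} (h : x ≠ y) :
    choiceProb (permVec π) x y = if π y ≤ π x then 1 else 0 := by
  have h' : π x ≠ π y := π.injective.ne h
  rcases h.lt_or_gt with h | h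
  · simp [choiceProb, h, permVec]
  · simp only [choiceProb, h, h.not_gt, permVec, dite_true, dite_false]
    rcases h'.lt_or_gt with h' | h'
    · simp [h'.le, h'.not_ge]
    · simp [h'.le, h'.not_ge]

theorem setRU_eq_convexHull (n : ℕ) : setRU n = convexHull ℝ (Set.range (permVec (n := n))) := by
  ext ρ
  have key : ∀ ν : Equiv.Perm (Fin n) → ℝ, ∑ π, ν π = 1 →
      ((∀ x y, x ≠ y → choiceProb ρ x y = ∑ π, ν π * (if π y ≤ π x then 1 else 0)) ↔
        ∑ π, ν π • permVec π = ρ) := by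
    intro ν hν
    rw [← choiceProb_eq_sum_iff hν]
    refine forall_congr' fun x => forall_congr' fun y => forall_congr' fun h => ?_
    simp only [choiceProb_permVec _ h]
  rw [convexHull_range_eq_exists_affineCombination]
  constructor
  · rintro ⟨ν, h0, h1, h⟩
    refine ⟨Finset.univ, ν, fun i _ => h0 i, h1, ?_⟩
    rw [Finset.affineCombination_eq_linear_combination _ _ _ h1]
    exact (key ν h1).1 h
  · rintro ⟨s, w, h0, h1, h⟩
    have h1' : ∑ π, (if π ∈ s then w π else 0) = 1 := by simpa using h1
    refine ⟨fun π => if π ∈ s then w π else 0, fun π => ?_, h1', (key _ h1').2 ?_⟩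
    · dsimp only; split_ifs with h
      · exact h0 π h
      · exact le_rfl
    · rw [Finset.affineCombination_eq_linear_combination _ _ _ h1] at h
      rw [← h]; simp [ite_smul, Finset.sum_ite_mem]

theorem convex_setRU (n : ℕ) : Convex ℝ (setRU n) := by
  rw [setRU_eq_convexHull]; exact convex_convexHull ℝ _

theorem isClosed_setRU (n : ℕ) : IsClosed (setRU n) := by
  rw [setRU_eq_convexHull]; exact (Set.finite_range _).isClosed_convexHull ℝ

theorem exists_perm_le_iff {α : Type*} [LinearOrder α] {g : Fin n → α}
    (hg : Function.Injective g) : ∃ π : Equiv.Perm (Fin n), ∀ x y, π x ≤ π y ↔ g x ≤ g y := by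
  have hm : StrictMono (g ∘ Tuple.sort g) :=
    (Tuple.monotone_sort g).strictMono_of_injective (hg.comp (Equiv.injective _))
  exact ⟨(Tuple.sort g)⁻¹, fun x y => by
    simpa using (hm.le_iff_le (a := (Tuple.sort g)⁻¹ x) (b := (Tuple.sort g)⁻¹ y)).symm⟩

theorem exists_perm_refining (u : Fin n → ℝ) :
    ∃ π : Equiv.Perm (Fin n), ∀ x y, π x ≤ π y → u x ≤ u y := by
  refine ⟨(Tuple.sort u)⁻¹, fun x y h => ?_⟩
  simpa using Tuple.monotone_sort u h

theorem permVec_mem_setRU (π : Equiv.Perm (Fin n)) : permVec π ∈ setRU n := by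
  rw [setRU_eq_convexHull]; exact subset_convexHull ℝ _ ⟨π, rfl⟩

/-- A relation that is the intersection of two linear orders gives a mixture of these two. -/
theorem relVec_mem_setRU_of_realizer {R : Fin n → Fin n → Prop} {σ τ : Fin n → ℕ}
    {π : Equiv.Perm (Fin n)}
    (hR : ∀ x y, R x y → π y < π x)
    (hc : ∀ x y, π x < π y → R y x → σ x < σ y ∧ τ x < τ y)
    (hi : ∀ x y, π x < π y → ¬ R y x → (σ x < σ y ∧ τ y < τ x) ∨ (σ y < σ x ∧ τ x < τ y)) :
    relVec R ∈ setRU n := by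
  have hinj : Function.Injective σ ∧ Function.Injective τ := by
    have : ∀ x y, π x < π y → σ x ≠ σ y ∧ τ x ≠ τ y := fun x y h => by
      by_cases hr : R y x
      · have := hc x y h hr; omega
      · have := hi x y h hr; omega
    constructor
    · intro x y hxy
      by_contra hne
      rcases (π.injective.ne hne).lt_or_gt with h | h
      · exact (this x y h).1 hxy
      · exact (this y x h).1 hxy.symm
    · intro x y hxy
      by_contra hne
      rcases (π.injective.ne hne).lt_or_gt with h | h
      · exact (this x y h).2 hxy
      · exact (this y x h).2 hxy.symm
  obtain ⟨s, hs⟩ := exists_perm_le_iff hinj.1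
  obtain ⟨t, ht⟩ := exists_perm_le_iff hinj.2
  -- A pair on which the two orders agree averages to 0 or 1, any other pair to 1/2.
  have : relVec R = (1 / 2 : ℝ) • permVec s + (1 / 2 : ℝ) • permVec t := by
    funext ⟨⟨x, y⟩, hxy⟩
    have hne : x ≠ y := ne_of_lt hxy
    have h1 := hR x y
    have h2 := hR y x
    simp only [relVec, permVec, Pi.add_apply, Pi.smul_apply, hs, ht, smul_eq_mul]
    rcases (π.injective.ne hne).lt_or_gt with h | h
    · have h3 := hc x y h
      have h4 := hi x y h
      have : ¬ R x y := fun hr => absurd (h1 hr) h.not_gt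
      by_cases hr : R y x
      · simp [this, hr, (h3 hr).1.not_ge, (h3 hr).2.not_ge]
      · rcases h4 hr with h5 | h5 <;> simp [this, hr, h5, h5.1.le, h5.2.le]
    · have h3 := hc y x h
      have h4 := hi y x h
      have : ¬ R y x := fun hr => absurd (h2 hr) h.not_gt
      by_cases hr : R x y
      · simp [hr, (h3 hr).1.le, (h3 hr).2.le]; norm_num
      · rcases h4 hr with h5 | h5 <;> simp [this, hr, h5, h5.1.le, h5.2.le]
  rw [this]
  exact convex_setRU n (permVec_mem_setRU s) (permVec_mem_setRU t) (by norm_num) (by norm_num)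
    (by norm_num)

/-! ### Small semiorders and posets have dimension at most two: finite check. -/

/-- The relation on `ℕ`, of larger to smaller numbers, whose bit at `(j, i)` with `i < j` has index
`j.choose 2 + i` in the code `c`. -/
def pairRel (c j i : ℕ) : Bool := c.testBit (j * (j - 1) / 2 + i)

/-- The linear order that agrees with the relation `c` and reverses the ranking `s` elsewhere. -/
def dualBelow (c : ℕ) (s : List ℕ) (j i : ℕ) : Bool :=
  if j < i then pairRel c i j || decide (s.getD i 0 < s.getD j 0)
  else decide (i < j) && !pairRel c j i && decide (s.getD i 0 < s.getD j 0)

/-- The position of `i` as the number of elements below it. That `dualBelow` is a linear order need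
not be proved: `realizes` tests the resulting ranks directly. -/
def dualRank (n c : ℕ) (s : List ℕ) (i : ℕ) : ℕ := (List.range n).countP fun j => dualBelow c s j i

/-- The relation `c` is the intersection of the ranking `s` and its dual. -/
def realizes (n c : ℕ) (s : List ℕ) : Bool :=
  let t := (List.range n).map (dualRank n c s)
  (List.range n).all fun j => (List.range j).all fun i =>
    bif pairRel c j i then decide (s.getD i 0 < s.getD j 0) && decide (t.getD i 0 < t.getD j 0)
    else (decide (s.getD i 0 < s.getD j 0) && decide (t.getD j 0 < t.getD i 0)) ||
      (decide (s.getD j 0 < s.getD i 0) && decide (t.getD i 0 < t.getD j 0))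

/-- Raising the upper element or lowering the lower one by a single step suffices; general moves are
iterates of these. -/
def semiorderCode (n c : ℕ) : Bool :=
  (List.range n).all fun j => (List.range j).all fun i => !pairRel c j i ||
    ((decide (j + 1 = n) || pairRel c (j + 1) i) && (decide (i = 0) || pairRel c j (i - 1)))

def posetCode (n c : ℕ) : Bool :=
  (List.range n).all fun k => (List.range k).all fun j => !pairRel c k j ||
    (List.range j).all fun i => !pairRel c j i || pairRel c k i

/-- Only the first order of each realizer is listed: the second is forced, since it must agree on
comparable pairs and reverse the others. -/
def semiorderExtensions : List (List ℕ) :=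
  [[0, 1, 2, 3, 4, 5], [0, 2, 1, 4, 3, 5], [2, 1, 0, 5, 4, 3], [0, 3, 2, 1, 5, 4],
    [1, 0, 4, 3, 2, 5], [0, 1, 3, 2, 4, 5], [0, 1, 3, 2, 5, 4], [0, 4, 3, 2, 1, 5],
    [1, 0, 3, 2, 4, 5], [0, 1, 2, 3, 5, 4], [0, 1, 4, 3, 2, 5], [0, 2, 1, 3, 4, 5],
    [0, 3, 2, 1, 4, 5]]

def posetExtensions : List (List ℕ) :=
  [[0, 1, 2, 3, 4], [0, 1, 2, 4, 3], [0, 2, 1, 3, 4], [1, 0, 2, 3, 4], [0, 1, 3, 2, 4],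
    [0, 1, 3, 4, 2], [2, 0, 1, 3, 4], [0, 1, 4, 2, 3], [1, 0, 2, 4, 3], [0, 2, 3, 1, 4],
    [0, 2, 3, 4, 1], [0, 3, 1, 2, 4], [0, 3, 1, 4, 2], [0, 2, 1, 4, 3], [0, 2, 4, 1, 3],
    [1, 3, 0, 4, 2], [0, 1, 4, 3, 2], [0, 4, 2, 1, 3], [1, 0, 3, 4, 2]]

-- The low six bits `a` encode the restriction to the first four points, the bits `b` the
-- comparisons with the fifth. Discarding invalid `a` before extending keeps the enumeration small.
set_option maxRecDepth 10000 in
theorem posetCode_realizes : ∀ a < 2 ^ 6, posetCode 4 a = true → ∀ b < 2 ^ 4,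
    posetCode 5 (b * 2 ^ 6 + a) = true →
      ∃ s ∈ posetExtensions, realizes 5 (b * 2 ^ 6 + a) s = true := by
  decide +kernel

set_option maxRecDepth 10000 in
theorem semiorderCode_realizes : ∀ a < 2 ^ 10, semiorderCode 5 a = true → ∀ b < 2 ^ 5,
    semiorderCode 6 (b * 2 ^ 10 + a) = true →
      ∃ s ∈ semiorderExtensions, realizes 6 (b * 2 ^ 10 + a) s = true := by
  decide +kernel

theorem pairRel_append_of_lt {k a j i : ℕ} (b : ℕ) (ha : a < 2 ^ (k * (k - 1) / 2)) (hj : j < k)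
    (hi : i < j) : pairRel (b * 2 ^ (k * (k - 1) / 2) + a) j i = pairRel a j i := by
  have h : j * (j - 1) / 2 + i < k * (k - 1) / 2 := by
    rw [← Nat.choose_two_right, ← Nat.choose_two_right]
    calc j.choose 2 + i < j.choose 2 + j := by omega
      _ = (j + 1).choose 2 := by rw [Nat.choose_succ_succ' j 1, Nat.choose_one_right, add_comm]
      _ ≤ k.choose 2 := Nat.choose_le_choose 2 hj
  rw [pairRel, pairRel, mul_comm, Nat.testBit_two_pow_mul_add _ ha, if_pos h]

theorem pairRel_append_self {k a : ℕ} (b i : ℕ) (ha : a < 2 ^ (k * (k - 1) / 2)) :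
    pairRel (b * 2 ^ (k * (k - 1) / 2) + a) k i = b.testBit i := by
  rw [pairRel, mul_comm, Nat.testBit_two_pow_mul_add _ ha, if_neg (by omega), Nat.add_sub_cancel_left]

theorem exists_code_extension (q : ℕ → ℕ → Bool) {k a : ℕ} (ha : a < 2 ^ (k * (k - 1) / 2))
    (haq : ∀ j < k, ∀ i < j, pairRel a j i = q j i) :
    ∃ b < 2 ^ k, ∀ j < k + 1, ∀ i < j, pairRel (b * 2 ^ (k * (k - 1) / 2) + a) j i = q j i := by
  refine ⟨Nat.ofBits fun i : Fin k => q k i, Nat.ofBits_lt_two_pow _, fun j hj i hi => ?_⟩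
  rcases Nat.lt_succ_iff_lt_or_eq.1 hj with h | rfl
  · rw [pairRel_append_of_lt _ ha h hi, haq j h i hi]
  · rw [pairRel_append_self _ _ ha, Nat.testBit_ofBits_lt _ _ hi]

theorem exists_code (q : ℕ → ℕ → Bool) (k : ℕ) :
    ∃ a < 2 ^ (k * (k - 1) / 2), ∀ j < k, ∀ i < j, pairRel a j i = q j i := by
  induction k with
  | zero => exact ⟨0, by simp, by simp⟩
  | succ k ih =>
    obtain ⟨a, ha, haq⟩ := ih
    obtain ⟨b, hb, hbq⟩ := exists_code_extension q ha haq
    refine ⟨_, ?_, hbq⟩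
    have : (k + 1) * (k + 1 - 1) / 2 = k * (k - 1) / 2 + k := by
      rw [← Nat.choose_two_right, ← Nat.choose_two_right, Nat.choose_succ_succ' k 1,
        Nat.choose_one_right, add_comm]
    rw [this, pow_add]
    calc b * 2 ^ (k * (k - 1) / 2) + a < (b + 1) * 2 ^ (k * (k - 1) / 2) := by rw [add_mul]; omega
      _ ≤ 2 ^ k * 2 ^ (k * (k - 1) / 2) := Nat.mul_le_mul_right _ hb
      _ = _ := mul_comm _ _

theorem lt_of_realizes {k c : ℕ} {s : List ℕ} (h : realizes k c s = true) :
    ∃ σ τ : ℕ → ℕ, ∀ j < k, ∀ i < j, (pairRel c j i = true → σ i < σ j ∧ τ i < τ j) ∧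
      (pairRel c j i = false → (σ i < σ j ∧ τ j < τ i) ∨ (σ j < σ i ∧ τ i < τ j)) := by
  refine ⟨fun i => s.getD i 0, fun i => ((List.range k).map (dualRank k c s)).getD i 0, ?_⟩
  intro j hj i hi
  simp only [realizes, List.all_eq_true, List.mem_range] at h
  have := h j hj i hi
  cases hp : pairRel c j i <;> simpa [hp] using this

theorem exists_realizer_of_posetCode {q : ℕ → ℕ → Bool}
    (hq : ∀ k j i, i < j → j < k → q k j = true → q j i = true → q k i = true) :
    ∃ σ τ : ℕ → ℕ, ∀ j < 5, ∀ i < j, (q j i = true → σ i < σ j ∧ τ i < τ j) ∧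
      (q j i = false → (σ i < σ j ∧ τ j < τ i) ∨ (σ j < σ i ∧ τ i < τ j)) := by
  have code : ∀ k c, (∀ j < k, ∀ i < j, pairRel c j i = q j i) → posetCode k c = true := by
    intro k c hc
    simp only [posetCode, List.all_eq_true, List.mem_range, Bool.or_eq_true, Bool.not_eq_true']
    intro l hl j hj
    rw [hc l hl j hj]
    refine (Bool.eq_false_or_eq_true (q l j)).symm.imp_right fun h1 i hi => ?_
    rw [hc l hl i (hi.trans hj), hc j (hj.trans hl) i hi]
    exact (Bool.eq_false_or_eq_true (q j i)).symm.imp_right fun h2 => hq l j i hi hj h1 h2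
  obtain ⟨a, ha, haq⟩ := exists_code q 4
  obtain ⟨b, hb, hbq⟩ := exists_code_extension q ha haq
  obtain ⟨s, -, hs⟩ := posetCode_realizes a ha (code 4 a haq) b hb (code 5 _ hbq)
  obtain ⟨σ, τ, h⟩ := lt_of_realizes hs
  exact ⟨σ, τ, fun j hj i hi => hbq j hj i hi ▸ h j hj i hi⟩

theorem exists_realizer_of_semiorderCode {q : ℕ → ℕ → Bool}
    (hq : ∀ j i j' i', i < j → j ≤ j' → i' ≤ i → q j i = true → q j' i' = true) :
    ∃ σ τ : ℕ → ℕ, ∀ j < 6, ∀ i < j, (q j i = true → σ i < σ j ∧ τ i < τ j) ∧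
      (q j i = false → (σ i < σ j ∧ τ j < τ i) ∨ (σ j < σ i ∧ τ i < τ j)) := by
  have code : ∀ k c, (∀ j < k, ∀ i < j, pairRel c j i = q j i) → semiorderCode k c = true := by
    intro k c hc
    simp only [semiorderCode, List.all_eq_true, List.mem_range, Bool.or_eq_true, Bool.not_eq_true',
      Bool.and_eq_true, decide_eq_true_eq]
    intro j hj i hi
    rw [hc j hj i hi]
    refine (Bool.eq_false_or_eq_true (q j i)).symm.imp_right fun h => ⟨?_, ?_⟩
    · by_cases hk : j + 1 = k
      · exact Or.inl hk
      · rw [hc (j + 1) (by omega) i (by omega)]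
        exact Or.inr (hq j i _ _ hi (by omega) le_rfl h)
    · rw [hc j hj (i - 1) (by omega)]
      exact Or.inr (hq j i _ _ hi le_rfl (by omega) h)
  obtain ⟨a, ha, haq⟩ := exists_code q 5
  obtain ⟨b, hb, hbq⟩ := exists_code_extension q ha haq
  obtain ⟨s, -, hs⟩ := semiorderCode_realizes a ha (code 5 a haq) b hb (code 6 _ hbq)
  obtain ⟨σ, τ, h⟩ := lt_of_realizes hs
  exact ⟨σ, τ, fun j hj i hi => hbq j hj i hi ▸ h j hj i hi⟩

-- Padding with top elements reduces `n ≤ k` to the single size checked by enumeration; it preserves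
-- both transitivity and the semiorder property.
open Classical in
/-- A relation on `Fin n`, transported along `π` and extended by new elements on top. -/
noncomputable def stackOnTop (R : Fin n → Fin n → Prop) (π : Equiv.Perm (Fin n)) (j i : ℕ) : Bool :=
  decide (n ≤ j ∨ ∃ x y, R x y ∧ (π x : ℕ) = j ∧ (π y : ℕ) = i)

theorem stackOnTop_apply (R : Fin n → Fin n → Prop) (π : Equiv.Perm (Fin n)) (x y : Fin n) :
    stackOnTop R π (π x) (π y) = true ↔ R x y := by
  simp only [stackOnTop, decide_eq_true_eq]
  constructor
  · rintro (h | ⟨x', y', h, hx, hy⟩)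
    · have := (π x).2; omega
    · rwa [π.injective (Fin.ext hx), π.injective (Fin.ext hy)] at h
  · exact fun h => Or.inr ⟨x, y, h, rfl, rfl⟩

theorem relVec_mem_setRU_of_stackOnTop {R : Fin n → Fin n → Prop} {π : Equiv.Perm (Fin n)}
    (hR : ∀ x y, R x y → π y < π x) {k : ℕ} (hn : n ≤ k)
    (h : ∃ σ τ : ℕ → ℕ, ∀ j < k, ∀ i < j, (stackOnTop R π j i = true → σ i < σ j ∧ τ i < τ j) ∧
      (stackOnTop R π j i = false → (σ i < σ j ∧ τ j < τ i) ∨ (σ j < σ i ∧ τ i < τ j))) :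
    relVec R ∈ setRU n := by
  obtain ⟨σ, τ, h⟩ := h
  refine relVec_mem_setRU_of_realizer (σ := fun x => σ (π x)) (τ := fun x => τ (π x)) hR
    (fun x y hxy hr => ?_) fun x y hxy hr => ?_
  · exact (h (π y) ((π y).2.trans_le hn) (π x) hxy).1 ((stackOnTop_apply R π y x).2 hr)
  · refine (h (π y) ((π y).2.trans_le hn) (π x) hxy).2 ?_
    rwa [← stackOnTop_apply R π, Bool.not_eq_true] at hr

theorem relVec_mem_setRU_of_trans (hn : n ≤ 5) {R : Fin n → Fin n → Prop} {π : Equiv.Perm (Fin n)}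
    (hR : ∀ x y, R x y → π y < π x) (ht : ∀ x y z, R x y → R y z → R x z) :
    relVec R ∈ setRU n := by
  refine relVec_mem_setRU_of_stackOnTop hR hn (exists_realizer_of_posetCode ?_)
  simp only [stackOnTop, decide_eq_true_eq]
  rintro k j i hij hjk (h | ⟨x, y, h, rfl, rfl⟩) h'
  · exact Or.inl h
  · rcases h' with h' | ⟨y', z, h', hy, rfl⟩
    · exact Or.inl (by omega)
    · obtain rfl := π.injective (Fin.ext hy)
      exact Or.inr ⟨x, z, ht _ _ _ h h', rfl, rfl⟩

theorem relVec_mem_setRU_of_semiorder (hn : n ≤ 6) {R : Fin n → Fin n → Prop}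
    {π : Equiv.Perm (Fin n)} (hR : ∀ x y, R x y → π y < π x)
    (hm : ∀ x y x' y', R x y → π x ≤ π x' → π y' ≤ π y → R x' y') : relVec R ∈ setRU n := by
  refine relVec_mem_setRU_of_stackOnTop hR hn (exists_realizer_of_semiorderCode ?_)
  simp only [stackOnTop, decide_eq_true_eq]
  rintro j i j' i' hij hj hi (h | ⟨x, y, h, rfl, rfl⟩)
  · exact Or.inl (by omega)
  · by_cases hj' : n ≤ j'
    · exact Or.inl hj'
    · have hi' : i' < n := by have := (π y).2; omega
      refine Or.inr ⟨π.symm ⟨j', by omega⟩, π.symm ⟨i', hi'⟩, hm _ _ _ _ h ?_ ?_, by simp, by simp⟩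
      · simpa [Fin.le_def] using hj
      · simpa [Fin.le_def] using hi

/-! ### Sigmoids converging to the step function with values 0, 1/2, 1. -/

/-- An odd strictly increasing sigmoid, sharper at `±1` for larger `k`. -/
noncomputable def sigmoidApprox (k : ℕ) (t : ℝ) : ℝ :=
  1 / 2 + 1 / 2 * (t ^ (2 * k + 1) / (1 + |t ^ (2 * k + 1)|))

theorem strictMono_div_one_add_abs : StrictMono fun s : ℝ => s / (1 + |s|) := by
  intro a b hab
  have ha : 0 < 1 + |a| := by positivity
  have hb : 0 < 1 + |b| := by positivity
  simp only
  rw [div_lt_div_iff₀ ha hb]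
  rcases abs_cases a with ⟨h, _⟩ | ⟨h, _⟩ <;> rcases abs_cases b with ⟨h', _⟩ | ⟨h', _⟩ <;>
    rw [h, h'] <;> nlinarith

theorem strictMono_sigmoidApprox (k : ℕ) : StrictMono (sigmoidApprox k) := by
  intro a b hab
  have hpow : StrictMono fun t : ℝ => t ^ (2 * k + 1) := Odd.strictMono_pow ⟨k, rfl⟩
  have := strictMono_div_one_add_abs (hpow hab)
  simp only [sigmoidApprox] at *
  linarith

theorem sigmoidApprox_mem (k : ℕ) (t : ℝ) : sigmoidApprox k t ∈ Set.Ioo (0 : ℝ) 1 := by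
  set s := t ^ (2 * k + 1) with hs
  have hp : 0 < 1 + |s| := by positivity
  have h1 : s / (1 + |s|) < 1 := by
    rw [div_lt_one hp]; linarith [le_abs_self s]
  have h2 : -1 < s / (1 + |s|) := by
    rw [lt_div_iff₀ hp]; linarith [neg_abs_le s]
  simp only [sigmoidApprox, ← hs]
  constructor <;> linarith

theorem sigmoidApprox_neg (k : ℕ) (t : ℝ) : sigmoidApprox k t = 1 - sigmoidApprox k (-t) := by
  have : Odd (2 * k + 1) := ⟨k, rfl⟩
  simp only [sigmoidApprox, this.neg_pow, abs_neg]
  ring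

theorem tendsto_sigmoidApprox_of_abs_lt {t : ℝ} (ht : |t| < 1) :
    Tendsto (fun k => sigmoidApprox k t) atTop (𝓝 (1 / 2)) := by
  have h : Tendsto (fun k : ℕ => 2 * k + 1) atTop atTop :=
    tendsto_atTop_mono (fun k => (by omega : k ≤ 2 * k + 1)) tendsto_id
  have h0 : Tendsto (fun k : ℕ => t ^ (2 * k + 1)) atTop (𝓝 0) :=
    (tendsto_pow_atTop_nhds_zero_of_abs_lt_one ht).comp h
  have h1 : Tendsto (fun k : ℕ => 1 / 2 + 1 / 2 * (t ^ (2 * k + 1) / (1 + |t ^ (2 * k + 1)|)))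
      atTop (𝓝 (1 / 2 + 1 / 2 * (0 / (1 + |0|)))) :=
    ((h0.div (h0.abs.const_add 1) (by simp)).const_mul _).const_add _
  simpa [sigmoidApprox] using h1

theorem tendsto_sigmoidApprox_of_one_lt {t : ℝ} (ht : 1 < t) :
    Tendsto (fun k => sigmoidApprox k t) atTop (𝓝 1) := by
  have h : Tendsto (fun k : ℕ => 2 * k + 1) atTop atTop :=
    tendsto_atTop_mono (fun k => (by omega : k ≤ 2 * k + 1)) tendsto_id
  have h0 : Tendsto (fun k : ℕ => 1 + t ^ (2 * k + 1)) atTop atTop :=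
    tendsto_atTop_add_const_left _ _ ((tendsto_pow_atTop_atTop_of_one_lt ht).comp h)
  have h1 : Tendsto (fun k : ℕ => 1 - 1 / 2 * (1 + t ^ (2 * k + 1))⁻¹) atTop
      (𝓝 (1 - 1 / 2 * 0)) := (h0.inv_tendsto_atTop.const_mul _).const_sub _
  rw [mul_zero, sub_zero] at h1
  refine h1.congr fun k => ?_
  have : 0 < t ^ (2 * k + 1) := by positivity
  rw [sigmoidApprox, abs_of_pos this]
  field_simp
  ring

theorem tendsto_sigmoidApprox_of_lt_neg_one {t : ℝ} (ht : t < -1) :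
    Tendsto (fun k => sigmoidApprox k t) atTop (𝓝 0) := by
  have := (tendsto_sigmoidApprox_of_one_lt (t := -t) (by linarith)).const_sub 1
  rw [sub_self] at this
  exact this.congr fun k => (sigmoidApprox_neg k t).symm

/-! ### Mixtures of model rules and half-vectors as limits of them. -/

theorem convex_setOf_hasCollectiveRep (M : ChoiceVec n → Prop) :
    Convex ℝ {ρ | HasCollectiveRep M ρ} := by
  suffices h : {ρ | HasCollectiveRep M ρ} = convexHull ℝ {ρ | M ρ} from h ▸ convex_convexHull ℝ _
  ext ρ
  constructor
  · rintro ⟨N, w, r, -, h0, h1, hM, h⟩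
    rw [choiceProb_eq_sum_iff h1] at h
    rw [← h]
    exact (convex_convexHull ℝ _).sum_mem (fun i _ => (h0 i).le) h1
      fun i _ => subset_convexHull ℝ _ (hM i)
  · intro h
    obtain ⟨ι, _, z, w, hz, -, h0, h1, h⟩ := eq_pos_convex_span_of_mem_convexHull h
    let e := Fintype.equivFin ι
    refine ⟨Fintype.card ι, w ∘ e.symm, z ∘ e.symm, ?_, fun i => h0 _, ?_, fun i => hz ⟨_, rfl⟩, ?_⟩
    · rw [Fintype.card_pos_iff]
      by_contra hne
      rw [not_nonempty_iff] at hne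
      simp at h1
    · simpa using (e.symm.sum_comp w).trans h1
    · rw [choiceProb_eq_sum_iff (by simpa using (e.symm.sum_comp w).trans h1), ← h]
      exact e.symm.sum_comp fun i => w i • z i

theorem hasCollectiveRep_of_model {M : ChoiceVec n → Prop} {ρ : ChoiceVec n} (h : M ρ) :
    HasCollectiveRep M ρ :=
  ⟨1, fun _ => 1, fun _ => ρ, one_pos, fun _ => one_pos, by simp, fun _ => h, by simp⟩

theorem closure_collective_subset {M : ChoiceVec n → Prop} {K : Set (ChoiceVec n)}
    (hK : Convex ℝ K) (hc : IsClosed K) (hM : ∀ ρ, M ρ → ρ ∈ K) :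
    closure {ρ | HasCollectiveRep M ρ} ⊆ K := by
  refine closure_minimal ?_ hc
  rintro ρ ⟨N, w, r, -, h0, h1, hr, h⟩
  rw [choiceProb_eq_sum_iff h1] at h
  rw [← h]
  exact hK.sum_mem (fun i _ => (h0 i).le) h1 fun i _ => hM _ (hr i)

theorem convex_closure_collective (M : ChoiceVec n → Prop) :
    Convex ℝ (closure {ρ | HasCollectiveRep M ρ}) :=
  (convex_setOf_hasCollectiveRep M).closure

theorem closure_model_subset (M : ChoiceVec n → Prop) :
    closure {ρ | M ρ} ⊆ closure {ρ | HasCollectiveRep M ρ} :=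
  closure_mono fun _ => hasCollectiveRep_of_model

/-- The rule `sigmoidApprox k (T x y)`, for antisymmetric `T`. -/
noncomputable def sigmoidVec (k : ℕ) (T : Fin n → Fin n → ℝ) : ChoiceVec n :=
  fun p => sigmoidApprox k (T p.1.1 p.1.2)

theorem choiceProb_sigmoidVec (k : ℕ) {T : Fin n → Fin n → ℝ} (hT : ∀ x y, T x y = -T y x)
    {x y : Fin n} (h : x ≠ y) : choiceProb (sigmoidVec k T) x y = sigmoidApprox k (T x y) := by
  rcases h.lt_or_gt with h | h
  · simp [choiceProb, h, sigmoidVec]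
  · simp [choiceProb, h, h.not_gt, sigmoidVec, hT x y, sigmoidApprox_neg k (-T y x)]

theorem relVec_mem_closure_of_sigmoidVec {M : ChoiceVec n → Prop} {R : Fin n → Fin n → Prop}
    {T : Fin n → Fin n → ℝ} (hM : ∀ k, M (sigmoidVec k T)) (hT : ∀ x y, T x y = -T y x)
    (hR : ∀ x y, R x y → 1 < T x y) (hN : ∀ x y, ¬ R x y → ¬ R y x → |T x y| < 1) :
    relVec R ∈ closure {ρ | M ρ} := by
  refine mem_closure_of_tendsto (b := atTop) (f := fun k => sigmoidVec k T) ?_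
    (Eventually.of_forall hM)
  rw [tendsto_pi_nhds]
  rintro ⟨⟨x, y⟩, hxy⟩
  simp only [sigmoidVec, relVec]
  split_ifs with h1 h2
  · exact tendsto_sigmoidApprox_of_one_lt (hR _ _ h1)
  · exact tendsto_sigmoidApprox_of_lt_neg_one (by have := hR _ _ h2; have := hT x y; linarith)
  · exact tendsto_sigmoidApprox_of_abs_lt (hN _ _ h1 h2)

/-- Gaps of exactly 1 are excluded because the sigmoids stay at 3/4 there instead of tending to 1 or
1/2. -/
theorem relVec_mem_closure_SS (u : Fin n → ℝ) (hu : ∀ x y, |u x - u y| ≠ 1) :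
    relVec (fun x y => u y + 1 < u x) ∈ closure {ρ : ChoiceVec n | HasSSRep ρ} := by
  refine relVec_mem_closure_of_sigmoidVec (T := fun x y => u x - u y) (fun k => ?_)
    (fun x y => by ring) (fun x y h => by linarith) fun x y h1 h2 => ?_
  · refine ⟨u, fun a b => sigmoidApprox k (a - b), fun a b => sigmoidApprox_mem k _,
      fun b a a' h => strictMono_sigmoidApprox k (by linarith),
      fun a b b' h => strictMono_sigmoidApprox k (by linarith), fun a b => ?_, fun x y h => ?_⟩
    · dsimp only; rw [sigmoidApprox_neg, neg_sub]
    · exact choiceProb_sigmoidVec k (fun x y => by ring) h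
  · refine lt_of_le_of_ne (abs_le.2 ⟨?_, ?_⟩) (hu x y) <;> linarith

theorem setRU_subset_setCollectiveSS (n : ℕ) : setRU n ⊆ setCollectiveSS n := by
  rw [setRU_eq_convexHull]
  refine convexHull_min ?_ (convex_closure_collective _)
  -- The factor 2 in the utility makes every gap between distinct alternatives exceed the threshold
  -- 1.
  rintro _ ⟨π, rfl⟩
  have key : ∀ x y, ((2 * (π y : ℕ) : ℝ) + 1 < 2 * (π x : ℕ)) ↔ π y < π x := fun x y => by
    rw [Fin.lt_def]; norm_cast; omega
  have : permVec π = relVec fun x y => (2 * (π y : ℕ) : ℝ) + 1 < 2 * (π x : ℕ) := by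
    funext ⟨⟨x, y⟩, hxy⟩
    have : π x ≠ π y := π.injective.ne (ne_of_lt hxy)
    simp only [permVec, relVec, key]
    rcases this.lt_or_gt with h | h
    · simp [h, h.not_gt, h.not_ge]
    · simp [h, h.le]
  rw [this]
  refine closure_model_subset _ (relVec_mem_closure_SS (fun x => 2 * (π x : ℕ)) fun x y h => ?_)
  have h' : |2 * ((π x : ℕ) : ℤ) - 2 * ((π y : ℕ) : ℤ)| = 1 := by exact_mod_cast h
  rcases abs_eq (zero_le_one' ℤ) |>.1 h' with h | h <;> omega

/-! ### Moderate and Weak Utility rules approximating a given relation. -/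

open Classical in
/-- Distances between the positions under `π`, lengthened for pairs incomparable under `R`. -/
noncomputable def stretchDist (R : Fin n → Fin n → Prop) (π : Equiv.Perm (Fin n)) (x y : Fin n) : ℝ :=
  if x = y then 0 else |((π x : ℕ) : ℝ) - (π y : ℕ)| + if R x y ∨ R y x then 0 else 1

theorem one_le_abs_sub (π : Equiv.Perm (Fin n)) {x y : Fin n} (h : x ≠ y) :
    1 ≤ |((π x : ℕ) : ℝ) - (π y : ℕ)| := by
  have : ((π x : ℕ) : ℤ) - (π y : ℕ) ≠ 0 := by
    have := Fin.val_ne_of_ne (π.injective.ne h); omega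
  exact_mod_cast Int.one_le_abs this

theorem isSemimetric_stretchDist (R : Fin n → Fin n → Prop) (π : Equiv.Perm (Fin n)) :
    IsSemimetric (stretchDist R π) := by
  refine ⟨fun x y => ?_, fun x y => ⟨fun h => ?_, fun h => by simp [stretchDist, h]⟩, fun x y => ?_⟩
  · unfold stretchDist; split_ifs <;> positivity
  · by_contra hne
    have := one_le_abs_sub π hne
    simp only [stretchDist, hne, if_false] at h
    split_ifs at h <;> linarith
  · simp only [stretchDist, abs_sub_comm ((π x : ℕ) : ℝ), eq_comm (a := x)]
    by_cases h : R x y <;> by_cases h' : R y x <;> simp [h, h']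

/-- Only a lengthened side `x z` with both other sides unlengthened is critical. By transitivity `y`
is then above both ends or below both, so the detour exceeds the direct distance by at least 2, more
than the added 1. -/
theorem isDistanceMetric_stretchDist {R : Fin n → Fin n → Prop} {π : Equiv.Perm (Fin n)}
    (hR : ∀ x y, R x y → π y < π x) (ht : ∀ x y z, R x y → R y z → R x z) :
    IsDistanceMetric (stretchDist R π) := by
  refine ⟨isSemimetric_stretchDist R π, fun x y z => ?_⟩
  by_cases hxy : x = y
  · subst hxy; simp [stretchDist]
  by_cases hyz : y = z
  · subst hyz; simp [stretchDist]
  have h0 := (isSemimetric_stretchDist R π).1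
  by_cases hxz : x = z
  · subst hxz
    have := h0 x y; have := h0 y x
    have : stretchDist R π x x = 0 := by simp [stretchDist]
    linarith
  have htri := abs_sub_le ((π x : ℕ) : ℝ) (π y : ℕ) (π z : ℕ)
  have h1 := one_le_abs_sub π hxy
  have h2 := one_le_abs_sub π hyz
  simp only [stretchDist, hxy, hyz, hxz, if_false]
  by_cases c1 : R x z ∨ R z x
  · rw [if_pos c1]; split_ifs <;> linarith
  by_cases c2 : R x y ∨ R y x
  swap
  · rw [if_neg c1, if_neg c2]; split_ifs <;> linarith
  by_cases c3 : R y z ∨ R z y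
  swap
  · rw [if_neg c1, if_pos c2, if_neg c3]; linarith
  rw [if_neg c1, if_pos c2, if_pos c3]
  have mono : ∀ a b, R a b → ((π b : ℕ) : ℝ) < (π a : ℕ) := fun a b h => by exact_mod_cast hR a b h
  have c1' : ¬ R x z ∧ ¬ R z x := not_or.1 c1
  rcases c2 with c2 | c2 <;> rcases c3 with c3 | c3
  · exact absurd (ht _ _ _ c2 c3) c1'.1
  · have := mono _ _ c2; have := mono _ _ c3
    rcases abs_cases (((π x : ℕ) : ℝ) - (π y : ℕ)) with h | h <;>
      rcases abs_cases (((π y : ℕ) : ℝ) - (π z : ℕ)) with h' | h' <;>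
      rcases abs_cases (((π x : ℕ) : ℝ) - (π z : ℕ)) with h'' | h'' <;> linarith
  · have := mono _ _ c2; have := mono _ _ c3
    rcases abs_cases (((π x : ℕ) : ℝ) - (π y : ℕ)) with h | h <;>
      rcases abs_cases (((π y : ℕ) : ℝ) - (π z : ℕ)) with h' | h' <;>
      rcases abs_cases (((π x : ℕ) : ℝ) - (π z : ℕ)) with h'' | h'' <;> linarith
  · exact absurd (ht _ _ _ c3 c2) c1'.2

theorem relVec_mem_closure_of_stretchDist {M : ChoiceVec n → Prop} {R : Fin n → Fin n → Prop}
    {π : Equiv.Perm (Fin n)} (hR : ∀ x y, R x y → π y < π x)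
    (hM : ∀ ρ u F, IsRatioRep ρ u F (stretchDist R π) → M ρ) :
    relVec R ∈ closure {ρ | M ρ} := by
  have hs : ∀ x y, stretchDist R π x y = stretchDist R π y x := (isSemimetric_stretchDist R π).2.2
  -- At position distance `d` the ratio is `1 + 1/n > 1` for comparable pairs and `(1 + 1/n) d / (d
  -- + 1)` for the others, which is below 1 because `d < n`.
  let u : Fin n → ℝ := fun x => (1 + 1 / n) * (π x : ℕ)
  have hT : ∀ x y, (u x - u y) / stretchDist R π x y = -((u y - u x) / stretchDist R π y x) :=
    fun x y => by rw [hs x y]; ring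
  refine relVec_mem_closure_of_sigmoidVec
    (T := fun x y => (u x - u y) / stretchDist R π x y) (fun k => ?_) hT (fun x y h => ?_)
    fun x y h1 h2 => ?_
  · exact hM _ u (sigmoidApprox k) ⟨fun t => Set.Ioo_subset_Icc_self (sigmoidApprox_mem k t),
      strictMono_sigmoidApprox k, sigmoidApprox_neg k, fun x y h => choiceProb_sigmoidVec k hT h⟩
  · have hlt : ((π y : ℕ) : ℝ) < (π x : ℕ) := by exact_mod_cast hR x y h
    have hne : x ≠ y := by rintro rfl; exact lt_irrefl _ hlt
    have hn : (0 : ℝ) < n := by exact_mod_cast x.pos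
    have hd : (0 : ℝ) < (π x : ℕ) - (π y : ℕ) := sub_pos.2 hlt
    simp only [stretchDist, hne, h, if_false, true_or, if_true, add_zero, abs_of_pos hd, u]
    rw [lt_div_iff₀ hd, ← mul_sub]
    have : 0 < 1 / (n : ℝ) := by positivity
    nlinarith
  · by_cases hne : x = y
    · simp [hne, stretchDist]
    have hn : (0 : ℝ) < n := by exact_mod_cast x.pos
    have hd : |((π x : ℕ) : ℝ) - (π y : ℕ)| < n := by
      have h1 : ((π x : ℕ) : ℝ) < n := by exact_mod_cast (π x).2
      have h2 : ((π y : ℕ) : ℝ) < n := by exact_mod_cast (π y).2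
      have h3 : (0 : ℝ) ≤ (π x : ℕ) := by positivity
      have h4 : (0 : ℝ) ≤ (π y : ℕ) := by positivity
      rw [abs_lt]; constructor <;> linarith
    simp only [stretchDist, hne, h1, h2, if_false, or_self, u]
    rw [← mul_sub, abs_div, abs_mul, abs_of_pos (by positivity : (0 : ℝ) < 1 + 1 / n)]
    set d := |((π x : ℕ) : ℝ) - (π y : ℕ)| with hdd
    have hd0 : 0 ≤ d := abs_nonneg _
    rw [abs_of_pos (by linarith), div_lt_one (by linarith)]
    have : 1 / (n : ℝ) * d < 1 := by rw [one_div, inv_mul_lt_one₀ hn]; exact hd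
    linarith

theorem relVec_mem_setCollectiveMU {R : Fin n → Fin n → Prop} {π : Equiv.Perm (Fin n)}
    (hR : ∀ x y, R x y → π y < π x) (ht : ∀ x y z, R x y → R y z → R x z) :
    relVec R ∈ setCollectiveMU n :=
  closure_model_subset _ <| relVec_mem_closure_of_stretchDist hR fun _ u F h =>
    ⟨u, F, _, isDistanceMetric_stretchDist hR ht, h⟩

theorem relVec_mem_setCollectiveWU {R : Fin n → Fin n → Prop} {π : Equiv.Perm (Fin n)}
    (hR : ∀ x y, R x y → π y < π x) : relVec R ∈ setCollectiveWU n :=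
  closure_model_subset _ <| relVec_mem_closure_of_stretchDist hR fun _ u F h =>
    ⟨u, F, _, isSemimetric_stretchDist R π, h⟩

/-! ### Decomposition of a rule into its level relations. -/

theorem setIntegral_Ioc_ite_le {a : ℝ} (h0 : 0 ≤ a) (h1 : a ≤ 1) (b c : ℝ) :
    ∫ s in Set.Ioc (0 : ℝ) 1, (if s ≤ a then b else c) = a * b + (1 - a) * c := by
  have hu : Set.Ioc (0 : ℝ) 1 = Set.Ioc 0 a ∪ Set.Ioc a 1 := (Set.Ioc_union_Ioc_eq_Ioc h0 h1).symm
  have e1 : Set.EqOn (fun s => if s ≤ a then b else c) (fun _ => b) (Set.Ioc 0 a) :=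
    fun s hs => if_pos hs.2
  have e2 : Set.EqOn (fun s => if s ≤ a then b else c) (fun _ => c) (Set.Ioc a 1) :=
    fun s hs => if_neg hs.1.not_ge
  rw [hu, setIntegral_union (Set.Ioc_disjoint_Ioc_of_le le_rfl) measurableSet_Ioc,
    setIntegral_congr_fun measurableSet_Ioc e1, setIntegral_congr_fun measurableSet_Ioc e2]
  · simp [h0, h1]
  · exact (integrableOn_const (by simp)).congr_fun e1.symm measurableSet_Ioc
  · exact (integrableOn_const (by simp)).congr_fun e2.symm measurableSet_Ioc

theorem integrableOn_Ioc_ite_le (a b c : ℝ) :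
    IntegrableOn (fun s : ℝ => if s ≤ a then b else c) (Set.Ioc 0 1) := by
  refine Integrable.of_bound (C := max |b| |c|) ?_ (Eventually.of_forall fun s => ?_)
  · exact (Measurable.ite measurableSet_Iic measurable_const measurable_const).aestronglyMeasurable
  · rw [Real.norm_eq_abs]; split_ifs <;> simp

/-- A choice rule is a mixture of the half-vectors of its level relations. -/
theorem mem_of_levels_mem {ρ : ChoiceVec n} {π : Equiv.Perm (Fin n)} {K : Set (ChoiceVec n)}
    (hK : Convex ℝ K) (hc : IsClosed K)
    (hρ : ∀ x y, π y < π x → choiceProb ρ x y ∈ Set.Icc (1 / 2 : ℝ) 1)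
    (hl : ∀ t : ℝ, relVec (fun x y => π y < π x ∧ t ≤ choiceProb ρ x y) ∈ K) : ρ ∈ K := by
  -- The threshold is uniform on `[1/2, 1]`. A pair of probability `p ≥ 1/2` gets 1 on a share `2p -
  -- 1` of thresholds and 1/2 on the rest, so its mean is `p`.
  let f : ℝ → ChoiceVec n := fun s =>
    relVec fun x y => π y < π x ∧ (1 + s) / 2 ≤ choiceProb ρ x y
  have hf : ∀ p : Menu n, ∃ a b c : ℝ, 0 ≤ a ∧ a ≤ 1 ∧ a * b + (1 - a) * c = ρ p ∧
      (fun s => f s p) = fun s => if s ≤ a then b else c := by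
    rintro ⟨⟨x, y⟩, hxy⟩
    have hp : choiceProb ρ x y = ρ ⟨(x, y), hxy⟩ := choiceProb_of_lt ρ hxy
    have hsw := choiceProb_add_swap ρ x y
    rcases (π.injective.ne (ne_of_lt hxy : x ≠ y)).lt_or_gt with h | h
    · obtain ⟨h1, h2⟩ := hρ y x h
      refine ⟨2 * choiceProb ρ y x - 1, 0, 1 / 2, by linarith, by linarith, by linarith, ?_⟩
      funext s
      simp only [f, relVec, h, h.not_gt, false_and, true_and, if_false]
      exact if_congr (by constructor <;> intro <;> linarith) rfl rfl
    · obtain ⟨h1, h2⟩ := hρ x y h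
      refine ⟨2 * choiceProb ρ x y - 1, 1, 1 / 2, by linarith, by linarith, by linarith, ?_⟩
      funext s
      simp only [f, relVec, h, h.not_gt, false_and, true_and, if_false]
      exact if_congr (by constructor <;> intro <;> linarith) rfl rfl
  have hint : ∀ p, Integrable (fun s => f s p) (volume.restrict (Set.Ioc (0 : ℝ) 1)) := fun p => by
    obtain ⟨a, b, c, -, -, -, h⟩ := hf p
    rw [h]; exact integrableOn_Ioc_ite_le a b c
  have : IsProbabilityMeasure (volume.restrict (Set.Ioc (0 : ℝ) 1)) := ⟨by simp⟩
  have hmem := hK.integral_mem (μ := volume.restrict (Set.Ioc (0 : ℝ) 1)) (f := f) hc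
    (Eventually.of_forall fun s => hl _) (Integrable.of_eval hint)
  convert hmem using 1
  funext p
  obtain ⟨a, b, c, h0, h1, h2, h⟩ := hf p
  rw [eval_integral hint, h, setIntegral_Ioc_ite_le h0 h1, h2]

theorem mem_of_hasSSRep {ρ : ChoiceVec n} (h : HasSSRep ρ) {K : Set (ChoiceVec n)}
    (hK : Convex ℝ K) (hc : IsClosed K)
    (hl : ∀ (R : Fin n → Fin n → Prop) (π : Equiv.Perm (Fin n)), (∀ x y, R x y → π y < π x) →
      (∀ x y x' y', R x y → π x ≤ π x' → π y' ≤ π y → R x' y') → relVec R ∈ K) : ρ ∈ K := by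
  obtain ⟨u, F, h01, hm, ha, hs, h⟩ := h
  obtain ⟨π, hπ⟩ := exists_perm_refining u
  refine mem_of_levels_mem (π := π) hK hc (fun x y hxy => ?_) fun t =>
    hl _ π (fun x y h => h.1) ?_
  · rw [h x y (by rintro rfl; exact lt_irrefl _ hxy)]
    have h1 := (hm (u y)).monotone (hπ _ _ hxy.le)
    have h2 := hs (u y) (u y)
    exact ⟨by linarith, (h01 _ _).2.le⟩
  · rintro x y x' y' ⟨hxy, htx⟩ hx hy
    have hxy' := (hy.trans_lt hxy).trans_le hx
    refine ⟨hxy', htx.trans ?_⟩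
    rw [h x y (by rintro rfl; exact lt_irrefl _ hxy), h x' y' (by rintro rfl; exact lt_irrefl _ hxy')]
    exact ((hm (u y)).monotone (hπ _ _ hx)).trans ((ha (u x')).antitone (hπ _ _ hy))

theorem mem_of_hasMURep {ρ : ChoiceVec n} (h : HasMURep ρ) {K : Set (ChoiceVec n)}
    (hK : Convex ℝ K) (hc : IsClosed K)
    (hl : ∀ (R : Fin n → Fin n → Prop) (π : Equiv.Perm (Fin n)), (∀ x y, R x y → π y < π x) →
      (∀ x y z, R x y → R y z → R x z) → relVec R ∈ K) : ρ ∈ K := by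
  obtain ⟨u, F, c, ⟨⟨hc0, hce, hcs⟩, hct⟩, h01, hm, hs, h⟩ := h
  obtain ⟨π, hπ⟩ := exists_perm_refining u
  have hne : ∀ x y, π y < π x → x ≠ y := by rintro x _ hxy rfl; exact lt_irrefl _ hxy
  have hpos : ∀ x y, x ≠ y → 0 < c x y := fun x y hxy =>
    (hc0 x y).lt_of_ne fun h => hxy ((hce x y).1 h.symm)
  refine mem_of_levels_mem (π := π) hK hc (fun x y hxy => ?_) fun t =>
    hl _ π (fun x y h => h.1) ?_
  · rw [h x y (hne _ _ hxy)]
    have h1 : 0 ≤ (u x - u y) / c x y := div_nonneg (sub_nonneg.2 (hπ _ _ hxy.le)) (hc0 x y)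
    have h2 := hm.monotone h1
    have h3 := hs 0
    rw [neg_zero] at h3
    exact ⟨by linarith, (h01 _).2⟩
  · rintro x y z ⟨hxy, h1⟩ ⟨hyz, h2⟩
    have hxz := hyz.trans hxy
    refine ⟨hxz, ?_⟩
    rw [h _ _ (hne _ _ hxy)] at h1
    rw [h _ _ (hne _ _ hyz)] at h2
    rw [h _ _ (hne _ _ hxz)]
    have p1 := hpos _ _ (hne _ _ hxy)
    have p2 := hpos _ _ (hne _ _ hyz)
    have p3 := hpos _ _ (hne _ _ hxz)
    -- By the triangle inequality the ratio for `x, z` is at least the mediant of the ratios for `x,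
    -- y` and `y, z`, hence at least the smaller of the two.
    rcases le_total ((u x - u y) / c x y) ((u y - u z) / c y z) with hle | hle
    · refine h1.trans (hm.monotone ?_)
      have q : 0 ≤ (u x - u y) / c x y := div_nonneg (sub_nonneg.2 (hπ _ _ hxy.le)) p1.le
      rw [le_div_iff₀ p3]
      rw [le_div_iff₀ p2] at hle
      have e : (u x - u y) / c x y * c x y = u x - u y := div_mul_cancel₀ _ p1.ne'
      have := mul_le_mul_of_nonneg_left (hct x y z) q
      linarith
    · refine h2.trans (hm.monotone ?_)
      have q : 0 ≤ (u y - u z) / c y z := div_nonneg (sub_nonneg.2 (hπ _ _ hyz.le)) p2.le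
      rw [le_div_iff₀ p3]
      rw [le_div_iff₀ p1] at hle
      have e : (u y - u z) / c y z * c y z = u y - u z := div_mul_cancel₀ _ p2.ne'
      have := mul_le_mul_of_nonneg_left (hct x y z) q
      linarith

/-! ### Inclusions between the rationalizable sets. -/

theorem setCollectiveSS_subset_setRU (hn : n ≤ 6) : setCollectiveSS n ⊆ setRU n :=
  closure_collective_subset (convex_setRU n) (isClosed_setRU n) fun _ h =>
    mem_of_hasSSRep h (convex_setRU n) (isClosed_setRU n) fun _ _ hR hm =>
      relVec_mem_setRU_of_semiorder hn hR hm

theorem setCollectiveMU_subset_setRU (hn : n ≤ 5) : setCollectiveMU n ⊆ setRU n :=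
  closure_collective_subset (convex_setRU n) (isClosed_setRU n) fun _ h =>
    mem_of_hasMURep h (convex_setRU n) (isClosed_setRU n) fun _ _ hR ht =>
      relVec_mem_setRU_of_trans hn hR ht

theorem setCollectiveSS_subset_setCollectiveMU (n : ℕ) : setCollectiveSS n ⊆ setCollectiveMU n :=
  closure_collective_subset (convex_closure_collective _) isClosed_closure fun _ h =>
    mem_of_hasSSRep h (convex_closure_collective _) isClosed_closure fun _ _ hR hm =>
      relVec_mem_setCollectiveMU hR fun x _ _ hxy hyz => hm _ _ x _ hyz (hR _ _ hxy).le le_rfl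

theorem setCollectiveMU_subset_setCollectiveWU (n : ℕ) : setCollectiveMU n ⊆ setCollectiveWU n :=
  closure_mono fun _ ⟨N, w, r, hN, h0, h1, hr, h⟩ =>
    ⟨N, w, r, hN, h0, h1, fun i => let ⟨u, F, c, hc, hF⟩ := hr i; ⟨u, F, c, hc.1, hF⟩, h⟩

/-! ### Linear inequalities inherited from Random Utility. -/

section HalfSpace

variable {ι : Type*} [Fintype ι]

theorem convex_choiceProb_sum_le (w : ι → ℝ) (x y : ι → Fin n) (a : ℝ) :
    Convex ℝ {ρ : ChoiceVec n | ∑ i, w i * choiceProb ρ (x i) (y i) ≤ a} := by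
  intro ρ hρ σ hσ s t hs ht hst
  simp only [Set.mem_ofPred_eq] at *
  calc ∑ i, w i * choiceProb (s • ρ + t • σ) (x i) (y i)
      = s * ∑ i, w i * choiceProb ρ (x i) (y i) + t * ∑ i, w i * choiceProb σ (x i) (y i) := by
        rw [Finset.mul_sum, Finset.mul_sum, ← Finset.sum_add_distrib]
        exact Finset.sum_congr rfl fun i _ => by rw [choiceProb_combo hst]; ring
    _ ≤ s * a + t * a := by gcongr
    _ = a := by rw [← add_mul, hst, one_mul]

theorem isClosed_choiceProb_sum_le (w : ι → ℝ) (x y : ι → Fin n) (a : ℝ) :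
    IsClosed {ρ : ChoiceVec n | ∑ i, w i * choiceProb ρ (x i) (y i) ≤ a} :=
  isClosed_le (continuous_finsetSum _ fun i _ => (continuous_choiceProb (x i) (y i)).const_mul _)
    continuous_const

theorem choiceProb_sum_le_of_mem_setRU {w : ι → ℝ} {x y : ι → Fin n} {a : ℝ}
    (hxy : ∀ i, x i ≠ y i)
    (h : ∀ π : Equiv.Perm (Fin n), ∑ i, w i * (if π (y i) ≤ π (x i) then 1 else 0) ≤ a)
    {ρ : ChoiceVec n} (hρ : ρ ∈ setRU n) : ∑ i, w i * choiceProb ρ (x i) (y i) ≤ a := by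
  rw [setRU_eq_convexHull] at hρ
  refine convexHull_min ?_ (convex_choiceProb_sum_le w x y a) hρ
  rintro _ ⟨π, rfl⟩
  simpa only [Set.mem_ofPred_eq, choiceProb_permVec π (hxy _)] using h π

/-- An inequality valid for Random Utility on `m` alternatives holds for a Collective model on
`n` alternatives, provided that the model is inherited by restrictions. -/
theorem choiceProb_sum_le_of_collective {M : ChoiceVec n → Prop} {w : ι → ℝ} {x y : ι → Fin m}
    {a : ℝ} (e : Fin m ↪o Fin n) (hM : ∀ ρ, M ρ → restrictVec e ρ ∈ setRU m)
    (hxy : ∀ i, x i ≠ y i)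
    (h : ∀ π : Equiv.Perm (Fin m), ∑ i, w i * (if π (y i) ≤ π (x i) then 1 else 0) ≤ a)
    {ρ : ChoiceVec n} (hρ : ρ ∈ closure {ρ | HasCollectiveRep M ρ}) :
    ∑ i, w i * choiceProb ρ (e (x i)) (e (y i)) ≤ a := by
  refine closure_collective_subset (convex_choiceProb_sum_le w _ _ a)
    (isClosed_choiceProb_sum_le w _ _ a) (fun ρ hρ => ?_) hρ
  simpa only [choiceProb_restrictVec, Set.mem_ofPred_eq] using
    choiceProb_sum_le_of_mem_setRU hxy h (hM ρ hρ)

end HalfSpace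

theorem HasSSRep.restrict {ρ : ChoiceVec n} (h : HasSSRep ρ) (e : Fin m ↪o Fin n) :
    HasSSRep (restrictVec e ρ) := by
  obtain ⟨u, F, h1, h2, h3, h4, h5⟩ := h
  exact ⟨u ∘ e, F, h1, h2, h3, h4, fun x y hxy => by
    rw [choiceProb_restrictVec]; exact h5 _ _ (e.injective.ne hxy)⟩

theorem HasMURep.restrict {ρ : ChoiceVec n} (h : HasMURep ρ) (e : Fin m ↪o Fin n) :
    HasMURep (restrictVec e ρ) := by
  obtain ⟨u, F, c, ⟨⟨c1, c2, c3⟩, c4⟩, h1, h2, h3, h4⟩ := h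
  exact ⟨u ∘ e, F, fun x y => c (e x) (e y), ⟨⟨fun _ _ => c1 _ _,
    fun x y => (c2 _ _).trans e.injective.eq_iff, fun _ _ => c3 _ _⟩, fun _ _ _ => c4 _ _ _⟩,
    h1, h2, h3, fun x y hxy => by
      rw [choiceProb_restrictVec]; exact h4 _ _ (e.injective.ne hxy)⟩

theorem HasCollectiveRep.mem_closure {M : ChoiceVec n → Prop} {ρ : ChoiceVec n} (h : M ρ) :
    ρ ∈ closure {ρ | HasCollectiveRep M ρ} :=
  subset_closure (hasCollectiveRep_of_model h)

theorem perm_eq_zero_of_choiceProb_eq_one {ρ : ChoiceVec n} {ν : Equiv.Perm (Fin n) → ℝ}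
    (h0 : ∀ π, 0 ≤ ν π) (h1 : ∑ π, ν π = 1) {x y : Fin n}
    (h : choiceProb ρ x y = ∑ π, ν π * (if π y ≤ π x then 1 else 0)) (hρ : choiceProb ρ x y = 1)
    {π : Equiv.Perm (Fin n)} (hπ : π x < π y) : ν π = 0 := by
  have hs : ∑ π, ν π * (1 - if π y ≤ π x then 1 else 0) = 0 := by
    simp only [mul_sub, mul_one, Finset.sum_sub_distrib, h1, ← h, hρ, sub_self]
  have hz := (Finset.sum_eq_zero_iff_of_nonneg fun π _ =>
    mul_nonneg (h0 π) (by split_ifs <;> norm_num)).1 hs π (Finset.mem_univ π)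
  simpa [hπ.not_ge] using hz

/-! ### Three relations separating the models. -/

/-- Arrange the seven pairs in the cycle 02, 23, 35, 13, 34, 46, 24. Reversing two neighbours would
reverse a comparable pair (for 02 and 23, the pair 03), so at most three of the seven are reversed.
-/
theorem agreement_of_linearExtension {p : Fin 7 → ℕ}
    (h : ∀ i j : Fin 7, (i : ℕ) + 3 ≤ j → p i < p j) :
    (4 : ℝ) ≤ (if p 0 ≤ p 2 then 1 else 0) + (if p 1 ≤ p 3 then 1 else 0) +
      (if p 2 ≤ p 3 then 1 else 0) + (if p 2 ≤ p 4 then 1 else 0) +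
      (if p 3 ≤ p 4 then 1 else 0) + (if p 3 ≤ p 5 then 1 else 0) +
      (if p 4 ≤ p 6 then 1 else 0) := by
  have h03 := h 0 3 (by decide)
  have h04 := h 0 4 (by decide)
  have h05 := h 0 5 (by decide)
  have h14 := h 1 4 (by decide)
  have h15 := h 1 5 (by decide)
  have h16 := h 1 6 (by decide)
  have h25 := h 2 5 (by decide)
  have h26 := h 2 6 (by decide)
  have h36 := h 3 6 (by decide)
  clear h
  split_ifs <;> first | (exfalso; omega) | norm_num

/-- The semiorder of gaps at least three. -/
def gapThree (x y : Fin n) : Prop := (y : ℕ) + 3 ≤ x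

theorem relVec_gapThree_mem_setCollectiveSS (n : ℕ) :
    relVec (gapThree (n := n)) ∈ setCollectiveSS n := by
  -- With utility step 2/5 the threshold 1 corresponds to a gap of 5/2, strictly between 2 and 3.
  have : gapThree (n := n) = fun x y : Fin n => (2 / 5 * (y : ℕ) : ℝ) + 1 < 2 / 5 * (x : ℕ) := by
    funext x y
    have : ((2 / 5 * (y : ℕ) : ℝ) + 1 < 2 / 5 * (x : ℕ)) ↔
        ((2 * (y : ℕ) + 5 : ℕ) : ℝ) < (2 * (x : ℕ) : ℕ) := by
      push_cast; constructor <;> intro <;> linarith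
    rw [this, Nat.cast_lt, gapThree, eq_iff_iff]
    omega
  rw [this]
  refine closure_model_subset _ (relVec_mem_closure_SS (fun x => 2 / 5 * (x : ℕ)) fun x y h => ?_)
  have h' : |2 * ((x : ℕ) : ℤ) - 2 * ((y : ℕ) : ℤ)| = 5 := by
    have : |2 * ((x : ℕ) : ℝ) - 2 * ((y : ℕ) : ℝ)| = 5 := by
      rw [show 2 * ((x : ℕ) : ℝ) - 2 * ((y : ℕ) : ℝ) = 5 * (2 / 5 * (x : ℕ) - 2 / 5 * (y : ℕ)) by ring,
        abs_mul, h]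
      norm_num
    exact_mod_cast this
  rcases abs_eq (by norm_num : (0 : ℤ) ≤ 5) |>.1 h' with h | h <;> omega

theorem relVec_gapThree_notMem_setRU (hn : 7 ≤ n) : relVec (gapThree (n := n)) ∉ setRU n := by
  rintro ⟨ν, h0, h1, h⟩
  classical
  let e : Fin 7 → Fin n := Fin.castLE hn
  have he : ∀ i : Fin 7, ((e i : Fin n) : ℕ) = i := fun i => rfl
  have hR : ∀ x y : Fin n, gapThree x y → ¬ gapThree y x := by
    intro x y; simp only [gapThree]; omega
  have half : ∀ i j : Fin 7, (i : ℕ) < j → (j : ℕ) ≤ i + 2 →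
      ∑ π, ν π * (if π (e i) ≤ π (e j) then 1 else 0) = 1 / 2 := by
    intro i j hij hji
    rw [← h (e j) (e i) (by intro h'; have := congrArg Fin.val h'; simp only [he] at this; omega),
      choiceProb_relVec hR, if_neg, if_neg] <;> simp only [gapThree, he] <;> omega
  -- Orders that are not linear extensions have weight zero; all others agree on at least 4 of the 7
  -- pairs. Yet each pair has probability 1/2, for an expected agreement of 7/2.
  have key : ∀ π, ν π * 4 ≤ ν π * ((if π (e 0) ≤ π (e 2) then 1 else 0) +
      (if π (e 1) ≤ π (e 3) then 1 else 0) + (if π (e 2) ≤ π (e 3) then 1 else 0) +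
      (if π (e 2) ≤ π (e 4) then 1 else 0) + (if π (e 3) ≤ π (e 4) then 1 else 0) +
      (if π (e 3) ≤ π (e 5) then 1 else 0) + (if π (e 4) ≤ π (e 6) then 1 else 0)) := by
    intro π
    by_cases hπ : ∀ i j : Fin 7, (i : ℕ) + 3 ≤ j → ((π (e i) : Fin n) : ℕ) < π (e j)
    · exact mul_le_mul_of_nonneg_left (agreement_of_linearExtension hπ) (h0 π)
    · push Not at hπ
      obtain ⟨i, j, hij, hle⟩ := hπ
      have hne : e j ≠ e i := by
        intro h'; have := congrArg Fin.val h'; simp only [he] at this; omega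
      have h2 : choiceProb (relVec (gapThree (n := n))) (e j) (e i) = 1 := by
        rw [choiceProb_relVec hR, if_pos]; simpa only [gapThree, he] using hij
      rw [perm_eq_zero_of_choiceProb_eq_one h0 h1 (h _ _ hne) h2
        (lt_of_le_of_ne hle (π.injective.ne hne)), zero_mul, zero_mul]
  have hsum := Finset.sum_le_sum fun π (_ : π ∈ Finset.univ) => key π
  simp only [mul_add, Finset.sum_add_distrib] at hsum
  rw [← Finset.sum_mul, h1, half 0 2, half 1 3, half 2 3, half 2 4, half 3 4, half 3 5, half 4 6]
    at hsum <;> first | decide | norm_num at hsum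

/-- The standard example of a poset of dimension three, on the first six alternatives. -/
def standardExample (x y : Fin n) : Prop :=
  (y : ℕ) < 3 ∧ 3 ≤ (x : ℕ) ∧ (x : ℕ) < 6 ∧ (x : ℕ) ≠ y + 3

theorem relVec_standardExample_mem_setCollectiveMU (n : ℕ) :
    relVec (standardExample (n := n)) ∈ setCollectiveMU n :=
  relVec_mem_setCollectiveMU (π := 1)
    (fun x y h => by
      have := h.1; have := h.2.1
      simp only [Equiv.Perm.one_apply, Fin.lt_def]; omega)
    fun x y z h h' => by have := h.1; have := h'.2.1; omega

theorem ite_le_pair (a b c d : ℕ) :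
    (if a ≤ b then (1 : ℝ) else 0) + (if c ≤ d then 1 else 0) - 1 ≤
      (if a ≤ d then 1 else 0) + (if c ≤ b then 1 else 0) := by
  split_ifs <;> first | (exfalso; omega) | norm_num

/-- By `ite_le_pair`, two diagonal comparisons force at least one off-diagonal one, and three force
at least three. -/
theorem three_fence (a b : Fin 3 → ℕ) :
    ∑ i : Fin 3 × Fin 3, (if i.1 = i.2 then (1 : ℝ) else -1) *
      (if b i.2 ≤ a i.1 then 1 else 0) ≤ 1 := by
  have h01 := ite_le_pair (b 0) (a 0) (b 1) (a 1)
  have h02 := ite_le_pair (b 0) (a 0) (b 2) (a 2)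
  have h12 := ite_le_pair (b 1) (a 1) (b 2) (a 2)
  have nonneg : ∀ i j, (0 : ℝ) ≤ if b j ≤ a i then 1 else 0 := fun i j => by
    split_ifs <;> norm_num
  have := nonneg 0 1; have := nonneg 0 2; have := nonneg 1 0
  have := nonneg 1 2; have := nonneg 2 0; have := nonneg 2 1
  simp only [Fintype.sum_prod_type, Fin.sum_univ_three, Fin.reduceEq, if_true, if_false, one_mul,
    neg_mul]
  by_cases h0 : b 0 ≤ a 0 <;> by_cases h1 : b 1 ≤ a 1 <;> by_cases h2 : b 2 ≤ a 2 <;>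
    simp only [h0, h1, h2, if_true, if_false] at * <;> linarith

theorem relVec_standardExample_notMem_setCollectiveSS (hn : 6 ≤ n) :
    relVec (standardExample (n := n)) ∉ setCollectiveSS n := by
  intro h
  classical
  let e : Fin 6 ↪o Fin n := Fin.castLEOrderEmb hn
  have he : ∀ i : Fin 6, ((e i : Fin n) : ℕ) = i := fun i => rfl
  have hR : ∀ x y : Fin n, standardExample x y → ¬ standardExample y x := by
    intro x y; simp only [standardExample]; omega
  -- On six points Simple Scalability lies in Random Utility, so the fence inequality carries over;
  -- the standard example gives it the value 3/2.
  have hfence := choiceProb_sum_le_of_collective (ι := Fin 3 × Fin 3)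
    (w := fun i => if i.1 = i.2 then 1 else -1) (x := fun i => Fin.castAdd 3 i.1)
    (y := fun i => Fin.natAdd 3 i.2) (a := 1) e
    (fun ρ hρ => setCollectiveSS_subset_setRU le_rfl
      (HasCollectiveRep.mem_closure (HasSSRep.restrict hρ e)))
    (fun i hi => by
      have h1 : (i.1 : ℕ) = 3 + i.2 := congrArg Fin.val hi
      have h2 := i.1.2
      omega)
    (fun π => three_fence (fun i => π (Fin.castAdd 3 i)) fun j => π (Fin.natAdd 3 j)) h
  have hval : ∀ i : Fin 3 × Fin 3, choiceProb (relVec (standardExample (n := n)))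
      (e (Fin.castAdd 3 i.1)) (e (Fin.natAdd 3 i.2)) = if i.1 = i.2 then 1 / 2 else 0 := by
    rintro ⟨i, j⟩
    have hi := i.2; have hj := j.2
    rw [choiceProb_relVec hR, if_neg (by
      simp only [standardExample, he, Fin.val_castAdd, Fin.val_natAdd]; omega)]
    by_cases hij : i = j
    · rw [if_neg, if_pos hij]
      simp only [standardExample, he, Fin.val_castAdd, Fin.val_natAdd, hij]; omega
    · rw [if_pos, if_neg hij]
      have := Fin.val_ne_of_ne hij
      simp only [standardExample, he, Fin.val_castAdd, Fin.val_natAdd]; omega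
  simp only [hval] at hfence
  simp [Fintype.sum_prod_type] at hfence
  norm_num at hfence

/-- The acyclic, intransitive relation `2 > 1 > 0` on the first three alternatives. -/
def intransitiveChain (x y : Fin n) : Prop := (x : ℕ) = y + 1 ∧ (y : ℕ) < 2

theorem relVec_intransitiveChain_mem_setCollectiveWU (n : ℕ) :
    relVec (intransitiveChain (n := n)) ∈ setCollectiveWU n :=
  relVec_mem_setCollectiveWU (π := 1) fun x y h => by
    have := h.1
    simp only [Equiv.Perm.one_apply, Fin.lt_def]; omega

theorem three_cycle (a : ℕ) {b c : ℕ} (hbc : b ≠ c) :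
    (if b ≤ c then (1 : ℝ) else 0) + (if a ≤ b then 1 else 0) + (if c ≤ a then 1 else 0) ≤ 2 := by
  split_ifs <;> first | (exfalso; omega) | norm_num

theorem relVec_intransitiveChain_notMem_setCollectiveMU (hn : 3 ≤ n) :
    relVec (intransitiveChain (n := n)) ∉ setCollectiveMU n := by
  intro h
  classical
  let e : Fin 3 ↪o Fin n := Fin.castLEOrderEmb hn
  have he : ∀ i : Fin 3, ((e i : Fin n) : ℕ) = i := fun i => rfl
  have hR : ∀ x y : Fin n, intransitiveChain x y → ¬ intransitiveChain y x := by
    intro x y; simp only [intransitiveChain]; omega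
  -- Around the cycle the chain has probabilities 1, 1 and 1/2, with sum above 2.
  have hcycle := choiceProb_sum_le_of_collective (ι := Fin 3) (w := fun _ => 1)
    (x := ![2, 1, 0]) (y := ![1, 0, 2]) (a := 2) e
    (fun ρ hρ => setCollectiveMU_subset_setRU (by norm_num)
      (HasCollectiveRep.mem_closure (HasMURep.restrict hρ e)))
    (by decide)
    (fun π => by
      have h12 := Fin.val_ne_of_ne (π.injective.ne (by decide : (1 : Fin 3) ≠ 2))
      simp only [Fin.sum_univ_three, Matrix.cons_val, one_mul]
      exact three_cycle (π 0) h12) h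
  simp only [Fin.sum_univ_three, Matrix.cons_val, choiceProb_relVec hR, intransitiveChain, he]
    at hcycle
  norm_num at hcycle

theorem lemma2 :
    ((∀ n : ℕ, setRU n ⊆ setCollectiveSS n) ∧
      (∀ n : ℕ, n ≤ 6 → setRU n = setCollectiveSS n) ∧
      (∀ n : ℕ, 7 ≤ n → setRU n ⊂ setCollectiveSS n)) ∧
    ((∀ n : ℕ, setCollectiveSS n ⊆ setCollectiveMU n) ∧
      (∀ n : ℕ, n ≤ 5 → setCollectiveSS n = setCollectiveMU n) ∧
      (∀ n : ℕ, 6 ≤ n → setCollectiveSS n ⊂ setCollectiveMU n)) ∧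
    (∀ n : ℕ, 3 ≤ n → setCollectiveMU n ⊂ setCollectiveWU n) := by
  refine ⟨⟨setRU_subset_setCollectiveSS, fun n hn => ?_, fun n hn => ?_⟩,
    ⟨setCollectiveSS_subset_setCollectiveMU, fun n hn => ?_, fun n hn => ?_⟩, fun n hn => ?_⟩
  · exact (setRU_subset_setCollectiveSS n).antisymm (setCollectiveSS_subset_setRU hn)
  · exact ⟨setRU_subset_setCollectiveSS n, fun h =>
      relVec_gapThree_notMem_setRU hn (h (relVec_gapThree_mem_setCollectiveSS n))⟩
  · exact (setCollectiveSS_subset_setCollectiveMU n).antisymm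
      ((setCollectiveMU_subset_setRU hn).trans (setRU_subset_setCollectiveSS n))
  · exact ⟨setCollectiveSS_subset_setCollectiveMU n, fun h =>
      relVec_standardExample_notMem_setCollectiveSS hn
        (h (relVec_standardExample_mem_setCollectiveMU n))⟩
  · exact ⟨setCollectiveMU_subset_setCollectiveWU n, fun h =>
      relVec_intransitiveChain_notMem_setCollectiveMU hn
        (h (relVec_intransitiveChain_mem_setCollectiveWU n))⟩
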